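/- Let $n,r\ge 0$ be integers, let $g_1,\dots,g_r\in\mathbb R[x]=\mathbb R[x_1,\dots,x_n]$, put $X=\{x\in\mathbb R^n: g_1(x)\ge 0,\dots,g_r(x)\ge 0\}$, and let $f\in\mathbb R[x]$ satisfy $f(x)\ge 0$ for all $x\in X$. Let $\sum\mathbb R[x]^2$ and $\sum\mathbb R[t]^2$ denote the sets of sums of squares of polynomials in $\mathbb R[x]$ and in $\mathbb R[t]$ ($t$ a single variable), and put $$P(g_1,\dots,g_r)=\Big\{\sigma_0+\sum_{i=1}^r\sigma_i g_i:\ \sigma_0,\dots,\sigma_r\in\sum\mathbb R[x]^2\Big\},$$ $$\mathcal S(g_1,\dots,g_r)=\Big\{\sigma_0+\sum_{i=1}^r\varphi(g_i)\,g_i:\ \sigma_0\in\sum\mathbb R[x]^2,\ \varphi\in\sum\mathbb R[t]^2\Big\}$$ (in the second set the same $\varphi$ is used for all $i$). Then there exists a sequence of polynomials $f_\nu$, $\nu\in\mathbb N$, such that every $f_\nu$ belongs to $P(g_1,\dots,g_r)$ and indeed to $\mathcal S(g_1,\dots,g_r)$, such that $f_\nu\to f$ uniformly on every compact subset of $\mathbb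 R^n$, and such that moreover $f_\nu\to f$ in the $l_1$-norm, i.e. the sum of the absolute values of the coefficients of $f_\nu-f$ tends to $0$. -/

import Mathlib

open Filter Topology

namespace SosApprox

/-- The closed basic semialgebraic set `{x ∈ ℝⁿ : g₁(x) ≥ 0, …, g_r(x) ≥ 0}`. -/
def basicClosedSet {n r : ℕ} (g : Fin r → MvPolynomial (Fin n) ℝ) : Set (Fin n → ℝ) :=
  {x | ∀ i, 0 ≤ MvPolynomial.eval x (g i)}

/-- The quadratic module `P(g₁, …, g_r)`: all `σ₀ + ∑ σᵢ gᵢ` with `σ₀, …, σ_r` sums of squares. -/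
def quadraticModule {n r : ℕ} (g : Fin r → MvPolynomial (Fin n) ℝ) :
    Set (MvPolynomial (Fin n) ℝ) :=
  {p | ∃ (σ₀ : MvPolynomial (Fin n) ℝ) (σ : Fin r → MvPolynomial (Fin n) ℝ),
    IsSumSq σ₀ ∧ (∀ i, IsSumSq (σ i)) ∧ p = σ₀ + ∑ i, σ i * g i}

/-- The set `S(g₁, …, g_r)`: all `σ₀ + ∑ φ(gᵢ) gᵢ` with `σ₀` a sum of squares in `ℝ[x]` and
one and the same sum of squares `φ` in `ℝ[t]` for all indices. -/
def sosCone {n r : ℕ} (g : Fin r → MvPolynomial (Fin n) ℝ) :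
    Set (MvPolynomial (Fin n) ℝ) :=
  {p | ∃ (σ₀ : MvPolynomial (Fin n) ℝ) (φ : Polynomial ℝ),
    IsSumSq σ₀ ∧ IsSumSq φ ∧ p = σ₀ + ∑ i, Polynomial.aeval (g i) φ * g i}

/-- The `l₁`-norm of a polynomial: the sum of the absolute values of its coefficients. -/
noncomputable def l1Norm {n : ℕ} (p : MvPolynomial (Fin n) ℝ) : ℝ :=
  ∑ m ∈ p.support, |MvPolynomial.coeff m p|

end SosApprox

namespace SosApprox

/-! For weight `R`, give the polynomials the norm `∑ |c_m| R ^ |m|`, which is submultiplicative,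
dominates values on the cube `|x_i| ≤ R` and, once `R ≥ 1`, dominates the `l₁`-norm. It suffices to
approximate `f` in this norm for every `R`.

Choose one `φ` with `t φ(t)` tiny for `t ≥ 0` and very negative for `t < 0`. Then `f - ∑ φ(g_i) g_i`
is nonnegative, up to a small constant, on a cube larger than `|x_i| ≤ R` (`exists_isSumSq_sum_le`).

A polynomial nonnegative on that larger cube is, up to a small constant, a norm limit of sums of
squares (`add_C_mem_sumSqClosure`). Indeed, the closure of the sums of squares is a semiring. It
contains `1 ± x_i / ρ` for `ρ > R`, because `1 - u` has a square root when the norm of `u` is below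
1 (`one_sub_mem_sumSqClosure`). The Bernstein expansion writes the polynomial, plus a constant, as a
nonnegative combination of products of these factors (`aeval_add_mem_of_nonneg_on_cube`). -/

/-! ### Closure of the sums of squares in a seminormed algebra -/

/-- The closure of the sums of squares with respect to a ring seminorm. -/
def sumSqClosure {A : Type*} [CommRing A] (N : RingSeminorm A) : Subsemiring A :=
  letI := N.toSeminormedRing
  (Subsemiring.sumSq A).topologicalClosure

theorem mem_sumSqClosure {A : Type*} [CommRing A] {N : RingSeminorm A} {p : A} :
    p ∈ sumSqClosure N ↔ ∀ ε > 0, ∃ σ, IsSumSq σ ∧ N (p - σ) < ε := by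
  let S : SeminormedRing A := N.toSeminormedRing
  change p ∈ closure ((Subsemiring.sumSq A : Subsemiring A) : Set A) ↔ _
  rw [SeminormedAddCommGroup.mem_closure_iff]
  refine forall₂_congr fun ε _ => exists_congr fun b => and_congr ?_ ?_
  · exact Subsemiring.mem_sumSq
  · exact Iff.rfl

theorem IsSumSq.mem_sumSqClosure {A : Type*} [CommRing A] {N : RingSeminorm A} {p : A}
    (hp : IsSumSq p) : p ∈ sumSqClosure N :=
  SosApprox.mem_sumSqClosure.2 fun ε hε => ⟨p, hp, by simpa using hε⟩

/-- If `N u < 1`, then `1 - u` is a limit of squares `(1 - y k) ^ 2`, where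
`y (k + 1) = (u + y k ^ 2) / 2`. -/
theorem one_sub_mem_sumSqClosure {A : Type*} [CommRing A] [Algebra ℝ A] (N : RingSeminorm A)
    (hN : ∀ (c : ℝ) p, N (c • p) = |c| * N p) {u : A} (hu : N u < 1) :
    1 - u ∈ sumSqClosure N := by
  let y : ℕ → A := Nat.rec 0 fun _ y => (2⁻¹ : ℝ) • (u + y * y)
  have hy : ∀ k, y (k + 1) = (2⁻¹ : ℝ) • (u + y k * y k) := fun _ => rfl
  have hu0 : 0 ≤ N u := apply_nonneg N u
  -- `1 - s` is the smaller fixed point of the scalar iteration `z ↦ (N u + z ^ 2) / 2`, hence a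
  -- bound for all `N (y k)`. Successive increments then shrink by the factor `1 - s < 1`.
  set s := Real.sqrt (1 - N u) with hs
  have hs2 : s * s = 1 - N u := Real.mul_self_sqrt (by linarith)
  have hs0 : 0 < s := Real.sqrt_pos.2 (by linarith)
  have hs1 : s ≤ 1 := by nlinarith
  have hbound : ∀ k, N (y k) ≤ 1 - s := by
    intro k
    induction k with
    | zero => simpa [y] using hs1
    | succ k ih =>
      rw [hy, hN, abs_of_pos (by norm_num)]
      have h1 := map_add_le_add N u (y k * y k)
      have h2 := map_mul_le_mul N (y k) (y k)
      have h3 := apply_nonneg N (y k)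
      nlinarith [mul_le_mul ih ih h3 (by linarith)]
  have hstep : ∀ k, N (y (k + 1) - y k) ≤ (1 - s) ^ k := by
    intro k
    induction k with
    | zero =>
      have h := hbound 1
      simp only [zero_add, pow_zero]
      have : y 1 - y 0 = y 1 := by simp [y]
      rw [this]; linarith
    | succ k ih =>
      have h1 : y (k + 1 + 1) - y (k + 1)
          = (2⁻¹ : ℝ) • ((y (k + 1) - y k) * (y (k + 1) + y k)) := by
        rw [hy (k + 1), hy k, ← smul_sub, ← hy k]
        congr 1; ring
      rw [h1, hN, abs_of_pos (by norm_num), pow_succ]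
      have h2 := map_mul_le_mul N (y (k + 1) - y k) (y (k + 1) + y k)
      have h3 := map_add_le_add N (y (k + 1)) (y k)
      have h4 := hbound k
      have h5 := hbound (k + 1)
      have h6 := mul_le_mul ih (h3.trans (add_le_add h5 h4)) (apply_nonneg N _)
        (pow_nonneg (by linarith) _)
      linarith
  rw [mem_sumSqClosure]
  intro ε hε
  obtain ⟨k, hk⟩ := exists_pow_lt_of_lt_one (show 0 < ε / 2 by linarith)
    (show 1 - s < 1 by linarith)
  refine ⟨(1 - y k) * (1 - y k), .mul_self _, ?_⟩
  have h2 : (2 : ℝ) • y (k + 1) = u + y k * y k := by rw [hy, smul_smul]; norm_num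
  -- The defect of the square is a multiple of one increment, so no limit of `y` is needed and `A`
  -- need not be complete.
  have : 1 - u - (1 - y k) * (1 - y k) = (-2 : ℝ) • (y (k + 1) - y k) := by
    rw [smul_sub, neg_smul, h2, neg_smul, two_smul]; ring
  rw [this, hN]
  have := hstep k
  norm_num
  linarith

/-! ### Weighted `l₁`-norms -/

/-- The weighted `l₁`-norm `∑ |c_m| R ^ |m|`. -/
noncomputable def weightedL1 {n : ℕ} (R : ℝ) (p : MvPolynomial (Fin n) ℝ) : ℝ :=
  ∑ m ∈ p.support, |MvPolynomial.coeff m p| * R ^ m.degree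

theorem weightedL1_eq_sum {n : ℕ} (R : ℝ) {p : MvPolynomial (Fin n) ℝ}
    {s : Finset (Fin n →₀ ℕ)} (hs : p.support ⊆ s) :
    weightedL1 R p = ∑ m ∈ s, |MvPolynomial.coeff m p| * R ^ m.degree :=
  Finset.sum_subset hs fun m _ hm => by
    rw [MvPolynomial.notMem_support_iff.1 hm]; simp

theorem weightedL1_add_le {n : ℕ} {R : ℝ} (hR : 0 ≤ R) (p q : MvPolynomial (Fin n) ℝ) :
    weightedL1 R (p + q) ≤ weightedL1 R p + weightedL1 R q := by
  classical
  rw [weightedL1_eq_sum R (MvPolynomial.support_add (p := p) (q := q)),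
    weightedL1_eq_sum R (Finset.subset_union_left (s₁ := p.support) (s₂ := q.support)),
    weightedL1_eq_sum R (Finset.subset_union_right (s₁ := p.support) (s₂ := q.support)),
    ← Finset.sum_add_distrib]
  refine Finset.sum_le_sum fun m _ => ?_
  rw [← add_mul, MvPolynomial.coeff_add]
  exact mul_le_mul_of_nonneg_right (abs_add_le _ _) (pow_nonneg hR _)

theorem weightedL1_monomial {n : ℕ} (R : ℝ) (m : Fin n →₀ ℕ) (a : ℝ) :
    weightedL1 R (MvPolynomial.monomial m a) = |a| * R ^ m.degree := by
  rw [weightedL1_eq_sum R (MvPolynomial.support_monomial_subset)]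
  simp

theorem weightedL1_smul {n : ℕ} (R c : ℝ) (p : MvPolynomial (Fin n) ℝ) :
    weightedL1 R (c • p) = |c| * weightedL1 R p := by
  rw [weightedL1_eq_sum R (MvPolynomial.support_smul (a := c) (f := p)), weightedL1,
    Finset.mul_sum]
  simp [abs_mul, mul_assoc]

theorem weightedL1_sum_le {n : ℕ} {R : ℝ} (hR : 0 ≤ R) {ι : Type*} (s : Finset ι)
    (p : ι → MvPolynomial (Fin n) ℝ) :
    weightedL1 R (∑ i ∈ s, p i) ≤ ∑ i ∈ s, weightedL1 R (p i) :=
  Finset.le_sum_of_subadditive (weightedL1 R) (by simp [weightedL1])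
    (weightedL1_add_le hR) s p

theorem weightedL1_mul_le {n : ℕ} {R : ℝ} (hR : 0 ≤ R) (p q : MvPolynomial (Fin n) ℝ) :
    weightedL1 R (p * q) ≤ weightedL1 R p * weightedL1 R q := by
  rw [MvPolynomial.mul_def, MvPolynomial.sum_def]
  refine (weightedL1_sum_le hR _ _).trans ?_
  rw [weightedL1, Finset.sum_mul]
  refine Finset.sum_le_sum fun m _ => ?_
  rw [MvPolynomial.sum_def]
  refine (weightedL1_sum_le hR _ _).trans ?_
  rw [weightedL1, Finset.mul_sum]
  refine Finset.sum_le_sum fun k _ => ?_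
  rw [weightedL1_monomial, abs_mul, map_add, pow_add]
  exact le_of_eq (by ring)

/-- The weighted `l₁`-norm as a ring seminorm. -/
noncomputable def weightedL1Seminorm (n : ℕ) {R : ℝ} (hR : 0 ≤ R) :
    RingSeminorm (MvPolynomial (Fin n) ℝ) where
  toFun := weightedL1 R
  map_zero' := by simp [weightedL1]
  add_le' := weightedL1_add_le hR
  neg' p := by simpa using weightedL1_smul R (-1) p
  mul_le' := weightedL1_mul_le hR

theorem abs_eval_le_weightedL1 {n : ℕ} {R : ℝ} {x : Fin n → ℝ} (hx : ∀ i, |x i| ≤ R)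
    (p : MvPolynomial (Fin n) ℝ) : |MvPolynomial.eval x p| ≤ weightedL1 R p := by
  rw [MvPolynomial.eval_eq']
  refine (Finset.abs_sum_le_sum_abs _ _).trans (Finset.sum_le_sum fun m _ => ?_)
  rw [abs_mul, Finset.abs_prod, Finsupp.degree_eq_sum, ← Finset.prod_pow_eq_pow_sum]
  gcongr with i
  rw [abs_pow]
  gcongr
  exact hx i

theorem l1Norm_le_weightedL1 {n : ℕ} {R : ℝ} (hR : 1 ≤ R) (p : MvPolynomial (Fin n) ℝ) :
    l1Norm p ≤ weightedL1 R p :=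
  Finset.sum_le_sum fun _ _ => le_mul_of_one_le_right (abs_nonneg _) (one_le_pow₀ hR)


/-! ### Bernstein expansion on the unit cube -/

/-- Compares the `k`-th Bernstein coefficient of `t ^ a` with its value at `k / N`. Raising `a` by
one multiplies the former by `(k - a) / (N - a)` and the latter by `k / N`; these factors differ by
at most `2 a / N`, and the errors add up. -/
theorem abs_choose_div_sub_pow_le {N k a : ℕ} (ha : 2 * a ≤ N) (hN : 0 < N) (hk : k ≤ N) :
    |(k.choose a : ℝ) / N.choose a - ((k : ℝ) / N) ^ a| ≤ 2 * a ^ 2 / N := by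
  have hN' : (0 : ℝ) < N := by exact_mod_cast hN
  have hk' : (k : ℝ) ≤ N := by exact_mod_cast hk
  have hkN0 : 0 ≤ (k : ℝ) / N := by positivity
  have hkN1 : (k : ℝ) / N ≤ 1 := (div_le_one hN').2 hk'
  induction a with
  | zero => simp
  | succ a ih =>
    have ih := ih (by omega)
    have haN : (2 * (a + 1) : ℝ) ≤ N := by exact_mod_cast ha
    have ha0 : (0 : ℝ) ≤ a := a.cast_nonneg
    have hNa : (0 : ℝ) < N - a := by linarith
    have hc : (0 : ℝ) < N.choose a := by exact_mod_cast Nat.choose_pos (by omega)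
    have hrec (l : ℕ) : (l.choose (a + 1) : ℝ) * (a + 1) = l.choose a * (l - a) := by
      rcases le_or_gt a l with h | h
      · have := Nat.choose_succ_right_eq l a
        rw [← Nat.cast_sub h]; exact_mod_cast this
      · simp [Nat.choose_eq_zero_of_lt h, Nat.choose_eq_zero_of_lt (h.trans a.lt_succ_self)]
    set P := (k.choose a : ℝ) / N.choose a with hP
    have hP0 : 0 ≤ P := by positivity
    have hP1 : P ≤ 1 := (div_le_one hc).2 (by exact_mod_cast Nat.choose_le_choose a hk)
    have key : (k.choose (a + 1) : ℝ) / N.choose (a + 1) = P * ((k - a) / (N - a)) := by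
      have h1 : (k.choose (a + 1) : ℝ) = k.choose a * (k - a) / (a + 1) := by
        rw [← hrec]; field_simp
      have h2 : (N.choose (a + 1) : ℝ) = N.choose a * (N - a) / (a + 1) := by
        rw [← hrec]; field_simp
      rw [h1, h2, hP]; field_simp
    have hd : |((k : ℝ) - a) / (N - a) - k / N| ≤ 2 * a / N := by
      have : ((k : ℝ) - a) / (N - a) - k / N = -(a / (N - a) * ((N - k) / N)) := by
        field_simp; ring
      rw [this, abs_neg, abs_of_nonneg (mul_nonneg (by positivity)
        (div_nonneg (by linarith) hN'.le))]
      have h1 : (a : ℝ) / (N - a) ≤ 2 * a / N := by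
        rw [div_le_div_iff₀ hNa hN']; nlinarith
      have h2 : ((N : ℝ) - k) / N ≤ 1 := (div_le_one hN').2 (by linarith [k.cast_nonneg (α := ℝ)])
      exact (mul_le_of_le_one_right (by positivity) h2).trans h1
    rw [key]
    have split : P * (((k : ℝ) - a) / (N - a)) - (k / N) ^ (a + 1)
        = P * (((k : ℝ) - a) / (N - a) - k / N) + (P - (k / N) ^ a) * (k / N) := by ring
    rw [split]
    refine (abs_add_le _ _).trans ?_
    rw [abs_mul, abs_mul, abs_of_nonneg hP0, abs_of_nonneg hkN0]
    have h1 : P * |((k : ℝ) - a) / (N - a) - k / N| ≤ 2 * a / N :=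
      (mul_le_of_le_one_left (abs_nonneg _) hP1).trans hd
    have h2 : |P - ((k : ℝ) / N) ^ a| * (k / N) ≤ 2 * a ^ 2 / N :=
      (mul_le_of_le_one_right (abs_nonneg _) hkN1).trans ih
    refine (add_le_add h1 h2).trans ?_
    rw [← add_div]
    gcongr
    push_cast; nlinarith

theorem abs_prod_sub_prod_le {ι : Type*} (s : Finset ι) (a b : ι → ℝ)
    (ha : ∀ i ∈ s, |a i| ≤ 1) (hb : ∀ i ∈ s, |b i| ≤ 1) :
    |∏ i ∈ s, a i - ∏ i ∈ s, b i| ≤ ∑ i ∈ s, |a i - b i| := by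
  classical
  induction s using Finset.induction_on with
  | empty => simp
  | insert i s hi ih =>
    rw [Finset.prod_insert hi, Finset.prod_insert hi, Finset.sum_insert hi]
    have ih := ih (fun j hj => ha j (Finset.mem_insert_of_mem hj))
      fun j hj => hb j (Finset.mem_insert_of_mem hj)
    have hp : |∏ j ∈ s, a j| ≤ 1 := by
      rw [Finset.abs_prod]
      exact Finset.prod_le_one (fun _ _ => abs_nonneg _)
        fun j hj => ha j (Finset.mem_insert_of_mem hj)
    have split : a i * ∏ j ∈ s, a j - b i * ∏ j ∈ s, b j
        = (a i - b i) * ∏ j ∈ s, a j + b i * (∏ j ∈ s, a j - ∏ j ∈ s, b j) := by ring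
    rw [split]
    refine (abs_add_le _ _).trans ?_
    rw [abs_mul, abs_mul]
    exact add_le_add (mul_le_of_le_one_right (abs_nonneg _) hp)
      ((mul_le_of_le_one_left (abs_nonneg _) (hb i (Finset.mem_insert_self _ _))).trans ih)

/-- The Bernstein expansion of a power. -/
theorem pow_eq_sum_bernstein {A : Type*} [CommRing A] [Algebra ℝ A] (u : A) {N a : ℕ}
    (ha : a ≤ N) :
    u ^ a = ∑ k ∈ Finset.range (N + 1), ((k.choose a : ℝ) / N.choose a) •
      (N.choose k * u ^ k * (1 - u) ^ (N - k)) := by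
  have hc : (N.choose a : ℝ) ≠ 0 := by exact_mod_cast (Nat.choose_pos ha).ne'
  have h : (N.choose a : ℝ) • u ^ a = ∑ k ∈ Finset.range (N + 1), (k.choose a : ℝ) •
      (N.choose k * u ^ k * (1 - u) ^ (N - k)) := by
    -- The terms with `k < a` vanish; the others are `u ^ a` times the binomial expansion of `(u +
    -- (1 - u)) ^ (N - a) = 1`.
    have hN : N + 1 = a + (N - a + 1) := by omega
    rw [hN, Finset.sum_range_add, Finset.sum_eq_zero fun k hk => by
      rw [Nat.choose_eq_zero_of_lt (Finset.mem_range.1 hk)]; simp, zero_add]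
    have hadd := add_pow u (1 - u) (N - a)
    rw [add_sub_cancel, one_pow] at hadd
    calc (N.choose a : ℝ) • u ^ a
        = (N.choose a : A) * u ^ a * 1 := by rw [mul_one, Nat.cast_smul_eq_nsmul, nsmul_eq_mul]
      _ = _ := by
        conv_lhs => rw [hadd, Finset.mul_sum]
        refine Finset.sum_congr rfl fun j _ => ?_
        have hm := Nat.choose_mul (n := N) (Nat.le_add_right a j)
        rw [Nat.add_sub_cancel_left] at hm
        have hm' : (N.choose (a + j) : A) * (a + j).choose a
            = N.choose a * (N - a).choose j := by exact_mod_cast congrArg (Nat.cast (R := A)) hm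
        rw [Nat.cast_smul_eq_nsmul, nsmul_eq_mul, Nat.sub_add_eq, pow_add]
        linear_combination (-(u ^ a * u ^ j * (1 - u) ^ (N - a - j))) * hm'
  simp_rw [div_eq_inv_mul, mul_smul]
  rw [← Finset.smul_sum, ← h, smul_smul, inv_mul_cancel₀ hc, one_smul]

/-- A polynomial that is nonnegative on the unit cube becomes, after adding a positive constant,
a nonnegative combination of the Bernstein basis. -/
theorem aeval_add_mem_of_nonneg_on_cube {A : Type*} [CommRing A] [Algebra ℝ A]
    (P : Subsemiring A) (hP : ∀ c : ℝ, 0 ≤ c → algebraMap ℝ A c ∈ P) {n : ℕ} (u : Fin n → A)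
    (hu : ∀ i, u i ∈ P) (hv : ∀ i, 1 - u i ∈ P) (H : MvPolynomial (Fin n) ℝ)
    (hH : ∀ x : Fin n → ℝ, (∀ i, 0 ≤ x i ∧ x i ≤ 1) → 0 ≤ MvPolynomial.eval x H)
    {ε : ℝ} (hε : 0 < ε) :
    MvPolynomial.aeval u H + algebraMap ℝ A ε ∈ P := by
  classical
  set C : ℝ := ∑ m ∈ H.support, |H.coeff m| * ∑ i, 2 * (m i : ℝ) ^ 2 with hC
  have hC0 : 0 ≤ C := by positivity
  obtain ⟨N₀, hN₀⟩ := exists_nat_gt (C / ε)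
  -- Large enough that the coefficient error `C / N` is at most `ε`, and at least twice every
  -- exponent in `H`.
  set N : ℕ := N₀ + 1 + 2 * ∑ m ∈ H.support, ∑ i, m i with hNdef
  have hNpos : 0 < N := by omega
  have hN' : (0 : ℝ) < N := by exact_mod_cast hNpos
  have hCN : C / N ≤ ε := by
    rw [div_le_iff₀ hN', ← div_le_iff₀' hε]
    have : (N₀ : ℝ) ≤ N := by exact_mod_cast (by omega)
    linarith
  have hdeg : ∀ m ∈ H.support, ∀ i, 2 * m i ≤ N := by
    intro m hm i
    have h1 : m i ≤ ∑ i, m i := Finset.single_le_sum (f := fun i => m i) (fun _ _ => Nat.zero_le _)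
      (Finset.mem_univ i)
    have h2 : ∑ i, m i ≤ ∑ m ∈ H.support, ∑ i, m i :=
      Finset.single_le_sum (f := fun m : Fin n →₀ ℕ => ∑ i, m i) (fun _ _ => Nat.zero_le _) hm
    omega
  let K : Finset (Fin n → ℕ) := Fintype.piFinset fun _ => Finset.range (N + 1)
  let B : (Fin n → ℕ) → A := fun k =>
    ∏ i, ((N.choose (k i) : A) * u i ^ k i * (1 - u i) ^ (N - k i))
  have hB : ∀ k, B k ∈ P := fun k => prod_mem fun i _ =>
    mul_mem (mul_mem (natCast_mem _ _) (pow_mem (hu i) _)) (pow_mem (hv i) _)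
  have hmon : ∀ m : Fin n → ℕ, (∀ i, m i ≤ N) → ∏ i, u i ^ m i
      = ∑ k ∈ K, (∏ i, ((k i).choose (m i) : ℝ) / N.choose (m i)) • B k := by
    intro m hm
    simp_rw [fun i => pow_eq_sum_bernstein (u i) (hm i)]
    rw [Finset.prod_univ_sum]
    refine Finset.sum_congr rfl fun k _ => ?_
    rw [← Finset.prod_smul]
  -- Partition of unity: it spreads the constant `ε` over all Bernstein coefficients, which are
  -- within `ε` of the nonnegative values of `H` at the grid points `k / N`.
  have hone : (1 : A) = ∑ k ∈ K, B k := by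
    simpa using hmon 0 (fun _ => Nat.zero_le _)
  let c : (Fin n → ℕ) → ℝ := fun k =>
    ∑ m ∈ H.support, H.coeff m * ∏ i, ((k i).choose (m i) : ℝ) / N.choose (m i)
  have hexp : MvPolynomial.aeval u H + algebraMap ℝ A ε
      = ∑ k ∈ K, algebraMap ℝ A (c k + ε) * B k := by
    rw [MvPolynomial.aeval_def, MvPolynomial.eval₂_eq']
    simp_rw [map_add, add_mul, Finset.sum_add_distrib, ← Finset.mul_sum, ← hone, mul_one]
    congr 1
    simp_rw [c, ← Algebra.smul_def, Finset.sum_smul]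
    rw [Finset.sum_comm]
    refine Finset.sum_congr rfl fun m hm => ?_
    rw [hmon m fun i => by have := hdeg m hm i; omega, Finset.smul_sum]
    simp_rw [mul_smul]
  rw [hexp]
  refine sum_mem fun k hk => mul_mem (hP _ ?_) (hB k)
  have hk' : ∀ i, k i ≤ N := fun i => by
    have := Fintype.mem_piFinset.1 hk i
    rw [Finset.mem_range] at this; omega
  have hpos := hH (fun i => (k i : ℝ) / N) fun i =>
    ⟨by positivity, (div_le_one hN').2 (by exact_mod_cast hk' i)⟩
  have hdiff : |c k - MvPolynomial.eval (fun i => (k i : ℝ) / N) H| ≤ C / N := by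
    rw [MvPolynomial.eval_eq', ← Finset.sum_sub_distrib, hC, Finset.sum_div]
    refine (Finset.abs_sum_le_sum_abs _ _).trans (Finset.sum_le_sum fun m hm => ?_)
    rw [← mul_sub, abs_mul, mul_div_assoc, Finset.sum_div]
    refine mul_le_mul_of_nonneg_left ?_ (abs_nonneg _)
    refine (abs_prod_sub_prod_le _ _ _ (fun i _ => ?_) fun i _ => ?_).trans
      (Finset.sum_le_sum fun i _ => abs_choose_div_sub_pow_le (hdeg m hm i) hNpos (hk' i))
    · rw [abs_of_nonneg (by positivity)]
      exact div_le_one_of_le₀ (by exact_mod_cast Nat.choose_le_choose _ (hk' i)) (by positivity)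
    · rw [abs_of_nonneg (by positivity)]
      exact pow_le_one₀ (by positivity) ((div_le_one hN').2 (by exact_mod_cast hk' i))
  have := (abs_le.1 hdiff).1
  linarith


/-! ### Choice of the common multiplier `φ` -/

/-- A square polynomial `φ` for which `t φ(t)` is close to `-L² max(0, -t)³`. -/
theorem exists_isSumSq_mul_near (L M : ℝ) {ε : ℝ} (hL : 0 ≤ L) (hM : 0 ≤ M) (hε : 0 < ε) :
    ∃ φ : Polynomial ℝ, IsSumSq φ ∧
      ∀ t, |t| ≤ M → φ.eval t * t ≤ ε - L ^ 2 * max 0 (-t) ^ 3 := by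
  have hD : 0 < (2 * (L * M) + 1) * M + 1 := by positivity
  -- Weierstrass for `L w`, `w = max 0 (-t)`. With `d` the error of `p`, `p ^ 2 t = -L ^ 2 w ^ 3 + d
  -- (2 L w + d) t`; the tolerance keeps the last term below `ε`.
  obtain ⟨p, hp⟩ := exists_polynomial_near_of_continuousOn (-M) M (fun t => L * max 0 (-t))
    (by fun_prop) (min 1 (ε / ((2 * (L * M) + 1) * M + 1))) (by positivity)
  refine ⟨p * p, .mul_self _, fun t ht => ?_⟩
  have h := hp t (abs_le.1 ht)
  set η := min 1 (ε / ((2 * (L * M) + 1) * M + 1)) with hη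
  have hη0 : 0 ≤ η := (abs_nonneg _).trans h.le
  have hη1 : η ≤ 1 := min_le_left _ _
  have hη2 : η * ((2 * (L * M) + 1) * M + 1) ≤ ε :=
    (le_div_iff₀ hD).1 (min_le_right _ _)
  set w := max 0 (-t) with hw
  have hw0 : 0 ≤ w := le_max_left _ _
  have hwM : w ≤ M := max_le hM (by linarith [(abs_le.1 ht).1])
  have hLw : L * w ≤ L * M := mul_le_mul_of_nonneg_left hwM hL
  have hLw0 : 0 ≤ L * w := by positivity
  have hwt : w ^ 2 * t = -w ^ 3 := by
    rcases le_total 0 (-t) with h0 | h0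
    · rw [hw, max_eq_right h0]; ring
    · rw [hw, max_eq_left h0]; ring
  set d := p.eval t - L * w with hd
  have hsum : |2 * (L * w) + d| ≤ 2 * (L * M) + 1 := by
    refine (abs_add_le _ _).trans ?_
    rw [abs_of_nonneg (by positivity)]
    linarith
  have hprod : |d| * |2 * (L * w) + d| * |t| ≤ η * (2 * (L * M) + 1) * M := by
    gcongr
  have heq : (p * p).eval t * t = -(L ^ 2 * w ^ 3) + d * (2 * (L * w) + d) * t := by
    rw [Polynomial.eval_mul, hd]
    linear_combination L ^ 2 * hwt
  have hle := le_abs_self (d * (2 * (L * w) + d) * t)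
  rw [abs_mul, abs_mul] at hle
  rw [heq]
  nlinarith

/-- On the compact set where `f ≤ -ε / 2` some `g i` is negative, so `∑ max 0 (-g i) ^ 3` has a
positive minimum there, and a large multiple of it outweighs the negative part of `f`. -/
theorem exists_isSumSq_sum_le {α : Type*} [TopologicalSpace α] {K : Set α} (hK : IsCompact K)
    {r : ℕ} {f : α → ℝ} {g : Fin r → α → ℝ} (hf : Continuous f) (hg : ∀ i, Continuous (g i))
    (hpos : ∀ x ∈ K, (∀ i, 0 ≤ g i x) → 0 ≤ f x) {ε : ℝ} (hε : 0 < ε) :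
    ∃ φ : Polynomial ℝ, IsSumSq φ ∧
      ∀ x ∈ K, ∑ i, φ.eval (g i x) * g i x ≤ f x + ε := by
  let s : α → ℝ := fun x => ∑ i, max 0 (-g i x) ^ 3
  have hs : Continuous s := by fun_prop
  have hs0 : ∀ x, 0 ≤ s x := fun x => Finset.sum_nonneg fun i _ => by positivity
  obtain ⟨L, hL0, hL⟩ : ∃ L : ℝ, 0 ≤ L ∧ ∀ x ∈ K, -(L ^ 2 * s x) ≤ f x + ε / 2 := by
    have hK' : IsCompact (K ∩ {x | f x ≤ -(ε / 2)}) :=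
      hK.inter_right (isClosed_le hf continuous_const)
    rcases (K ∩ {x | f x ≤ -(ε / 2)}).eq_empty_or_nonempty with he | hne
    · refine ⟨0, le_rfl, fun x hx => ?_⟩
      by_contra! hlt
      have : x ∈ K ∩ {x | f x ≤ -(ε / 2)} := ⟨hx, by simp at hlt; simp; linarith⟩
      simp [he] at this
    · obtain ⟨x₀, hx₀, hmin⟩ := hK'.exists_isMinOn hne hs.continuousOn
      obtain ⟨x₁, hx₁, hmin₁⟩ := hK'.exists_isMinOn hne hf.continuousOn
      have hsx₀ : 0 < s x₀ := by
        refine lt_of_le_of_ne (hs0 _) fun h0 => ?_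
        have hz := (Finset.sum_eq_zero_iff_of_nonneg fun i _ => by positivity).1 h0.symm
        have := hpos x₀ hx₀.1 fun i => by
          have := eq_zero_of_pow_eq_zero (hz i (Finset.mem_univ i))
          linarith [le_max_right 0 (-g i x₀)]
        have h2 : f x₀ ≤ -(ε / 2) := hx₀.2
        linarith
      refine ⟨Real.sqrt (|f x₁| / s x₀), Real.sqrt_nonneg _, fun x hx => ?_⟩
      rw [Real.sq_sqrt (by positivity)]
      by_cases hxf : f x ≤ -(ε / 2)
      · have h1 : s x₀ ≤ s x := hmin ⟨hx, hxf⟩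
        have h2 : f x₁ ≤ f x := hmin₁ ⟨hx, hxf⟩
        have h3 : |f x₁| / s x₀ * s x₀ ≤ |f x₁| / s x₀ * s x := by gcongr
        rw [div_mul_cancel₀ _ hsx₀.ne'] at h3
        linarith [neg_abs_le (f x₁)]
      · have : 0 ≤ |f x₁| / s x₀ * s x := mul_nonneg (by positivity) (hs0 x)
        linarith
  obtain ⟨M, hM⟩ := hK.exists_bound_of_continuousOn (f := fun x => ∑ i, |g i x|)
    (by fun_prop : Continuous _).continuousOn
  have hM' : ∀ x ∈ K, ∀ i, |g i x| ≤ max 0 M := fun x hx i => by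
    have h1 : |g i x| ≤ ∑ i, |g i x| :=
      Finset.single_le_sum (f := fun i => |g i x|) (fun _ _ => abs_nonneg _) (Finset.mem_univ i)
    exact h1.trans ((Real.le_norm_self _).trans ((hM x hx).trans (le_max_right _ _)))
  -- The `r` errors add up to at most `ε / 2`; dividing by `r + 1` also covers `r = 0`.
  obtain ⟨φ, hφ, hφle⟩ := exists_isSumSq_mul_near L (max 0 M) (ε := ε / 2 / (r + 1)) hL0
    (le_max_left _ _) (by positivity)
  refine ⟨φ, hφ, fun x hx => ?_⟩
  have h1 := Finset.sum_le_sum fun i (_ : i ∈ Finset.univ) => hφle (g i x) (hM' x hx i)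
  rw [Finset.sum_sub_distrib, ← Finset.mul_sum, Finset.sum_const, Finset.card_univ,
    Fintype.card_fin, nsmul_eq_mul] at h1
  have h2 : (r : ℝ) * (ε / 2 / (r + 1)) ≤ ε / 2 := by
    rw [mul_div_assoc', div_le_iff₀ (by positivity)]; nlinarith
  have h3 := hL x hx
  simp only [s] at h3
  linarith


/-! ### Approximation by sums of squares in the weighted norm -/

theorem algebraMap_mem_sumSqClosure {A : Type*} [CommRing A] [Algebra ℝ A] (N : RingSeminorm A)
    {c : ℝ} (hc : 0 ≤ c) : algebraMap ℝ A c ∈ sumSqClosure N := by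
  refine IsSumSq.mem_sumSqClosure ?_
  rw [← Real.mul_self_sqrt hc, map_mul]
  exact .mul_self _

theorem one_sub_smul_X_mem_sumSqClosure {n : ℕ} {R : ℝ} (hR : 0 ≤ R) {c : ℝ} (hc : |c| * R < 1)
    (i : Fin n) : 1 - c • MvPolynomial.X i ∈ sumSqClosure (weightedL1Seminorm n hR) := by
  refine one_sub_mem_sumSqClosure _ (weightedL1_smul R) ?_
  change weightedL1 R _ < 1
  rw [weightedL1_smul, MvPolynomial.X, weightedL1_monomial]
  simpa using hc

/-- A polynomial nonnegative on a cube of half-width larger than `R` is, up to a positive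
constant, a limit of sums of squares in the `l₁`-norm of weight `R`. -/
theorem add_C_mem_sumSqClosure {n : ℕ} {R ρ : ℝ} (hR : 0 ≤ R) (hρ : R < ρ)
    (h : MvPolynomial (Fin n) ℝ)
    (hh : ∀ x : Fin n → ℝ, (∀ i, |x i| ≤ ρ) → 0 ≤ MvPolynomial.eval x h)
    {ε : ℝ} (hε : 0 < ε) :
    h + MvPolynomial.C ε ∈ sumSqClosure (weightedL1Seminorm n hR) := by
  have hρ0 : 0 < ρ := hR.trans_lt hρ
  let N := weightedL1Seminorm n hR
  -- `u i = (1 + x_i / ρ) / 2` carries the cube of half-width `ρ` to the unit cube, and `w` is the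
  -- inverse substitution. As `x_i / ρ` has norm `R / ρ < 1`, both `u i` and `1 - u i` lie in the
  -- closure.
  let u : Fin n → MvPolynomial (Fin n) ℝ := fun i =>
    MvPolynomial.C 2⁻¹ * (1 - (-ρ⁻¹) • MvPolynomial.X i)
  let w : Fin n → MvPolynomial (Fin n) ℝ := fun i =>
    MvPolynomial.C ρ * (2 * MvPolynomial.X i - 1)
  have hlt : ρ⁻¹ * R < 1 := by rwa [inv_mul_lt_iff₀ hρ0, mul_one]
  have hC2 : (MvPolynomial.C 2⁻¹ : MvPolynomial (Fin n) ℝ) * 2 = 1 := by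
    rw [← map_ofNat MvPolynomial.C 2, ← map_mul]; norm_num
  have hCρ : (MvPolynomial.C ρ⁻¹ : MvPolynomial (Fin n) ℝ) * MvPolynomial.C ρ = 1 := by
    rw [← map_mul, inv_mul_cancel₀ hρ0.ne', map_one]
  have hhalf : (MvPolynomial.C 2⁻¹ : MvPolynomial (Fin n) ℝ) ∈ sumSqClosure N :=
    algebraMap_mem_sumSqClosure N (by norm_num)
  have hu : ∀ i, u i ∈ sumSqClosure N := fun i =>
    mul_mem hhalf (one_sub_smul_X_mem_sumSqClosure hR
      (by rwa [abs_neg, abs_of_pos (by positivity)]) i)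
  have hv : ∀ i, 1 - u i ∈ sumSqClosure N := fun i => by
    have heq : 1 - u i = MvPolynomial.C 2⁻¹ * (1 - ρ⁻¹ • MvPolynomial.X i) := by
      simp only [u, neg_smul]
      linear_combination -hC2
    rw [heq]
    exact mul_mem hhalf (one_sub_smul_X_mem_sumSqClosure hR
      (by rwa [abs_of_pos (by positivity)]) i)
  have key := aeval_add_mem_of_nonneg_on_cube (sumSqClosure N)
    (fun c hc => algebraMap_mem_sumSqClosure N hc) u hu hv (MvPolynomial.bind₁ w h)
    (fun x hx => by
      rw [← MvPolynomial.coe_aeval_eq_eval, RingHom.coe_coe, MvPolynomial.aeval_bind₁,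
        ← RingHom.coe_coe, MvPolynomial.coe_aeval_eq_eval]
      refine hh _ fun i => ?_
      have := hx i
      simp only [w, map_mul, map_sub, map_ofNat, MvPolynomial.algHom_C, MvPolynomial.aeval_X,
        map_one, Algebra.algebraMap_self_apply]
      rw [abs_mul, abs_of_pos hρ0]
      exact mul_le_of_le_one_right hρ0.le (abs_le.2 ⟨by linarith, by linarith⟩)) hε
  have hcomp : MvPolynomial.aeval u (MvPolynomial.bind₁ w h) = h := by
    have hw : ∀ i, MvPolynomial.aeval u (w i) = MvPolynomial.X i := fun i => by
      simp only [w, u, map_mul, map_sub, map_ofNat, MvPolynomial.aeval_X, map_one,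
        MvPolynomial.algHom_C, MvPolynomial.algebraMap_eq, neg_smul, MvPolynomial.smul_eq_C_mul]
      linear_combination (MvPolynomial.C ρ * (1 + MvPolynomial.C ρ⁻¹ * MvPolynomial.X i)) * hC2
        + MvPolynomial.X i * hCρ
    rw [MvPolynomial.aeval_bind₁]
    simp_rw [hw]
    exact MvPolynomial.aeval_X_left_apply h
  rwa [hcomp] at key

theorem IsSumSq.map {A B F : Type*} [Semiring A] [Semiring B] [FunLike F A B] [RingHomClass F A B]
    (φ : F) {a : A} (ha : IsSumSq a) : IsSumSq (φ a) := by
  induction ha with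
  | zero => simp
  | sq_add a _ ih => rw [map_add, map_mul]; exact .sq_add _ ih

theorem sosCone_subset_quadraticModule {n r : ℕ} (g : Fin r → MvPolynomial (Fin n) ℝ) :
    sosCone g ⊆ quadraticModule g := by
  rintro p ⟨σ₀, φ, hσ₀, hφ, rfl⟩
  exact ⟨σ₀, fun i => Polynomial.aeval (g i) φ, hσ₀,
    fun i => IsSumSq.map (Polynomial.aeval (g i)) hφ, rfl⟩

theorem exists_mem_sosCone_weightedL1_le {n r : ℕ} (g : Fin r → MvPolynomial (Fin n) ℝ)
    (f : MvPolynomial (Fin n) ℝ) (hf : ∀ x ∈ basicClosedSet g, 0 ≤ MvPolynomial.eval x f)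
    {R ε : ℝ} (hR : 0 ≤ R) (hε : 0 < ε) :
    ∃ F ∈ sosCone g, weightedL1 R (F - f) ≤ ε := by
  obtain ⟨φ, hφ, hle⟩ := exists_isSumSq_sum_le
    (isCompact_Icc (a := fun _ : Fin n => -(R + 1)) (b := fun _ => R + 1))
    (MvPolynomial.continuous_eval f) (fun i => MvPolynomial.continuous_eval (g i))
    (fun x _ hx => hf x hx) (show 0 < ε / 3 by linarith)
  set G : MvPolynomial (Fin n) ℝ := ∑ i, Polynomial.aeval (g i) φ * g i with hG
  have hmem := add_C_mem_sumSqClosure hR (lt_add_one R) (f + MvPolynomial.C (ε / 3) - G)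
    (fun x hx => by
      have := hle x ⟨fun i => (abs_le.1 (hx i)).1, fun i => (abs_le.1 (hx i)).2⟩
      have hev : ∀ i, MvPolynomial.eval x (Polynomial.aeval (g i) φ)
          = φ.eval (MvPolynomial.eval x (g i)) := fun i => by
        have := Polynomial.aeval_algHom_apply (MvPolynomial.aeval x) (g i) φ
        simpa [MvPolynomial.coe_aeval_eq_eval, Polynomial.coe_aeval_eq_eval] using this.symm
      simp only [hG, map_sub, map_add, map_sum, map_mul, MvPolynomial.eval_C, hev]
      linarith) (show 0 < ε / 3 by linarith)
  obtain ⟨σ, hσ, hlt⟩ := mem_sumSqClosure.1 hmem (ε / 3) (by linarith)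
  replace hlt : weightedL1 R (f + MvPolynomial.C (ε / 3) - G + MvPolynomial.C (ε / 3) - σ)
    < ε / 3 := hlt
  -- One `ε / 3` each for the choice of `φ`, the Bernstein constant and the distance to `σ`.
  refine ⟨σ + G, ⟨σ, φ, hσ, hφ, rfl⟩, ?_⟩
  have heq : σ + G - f = MvPolynomial.C (2 * (ε / 3))
      + (-1 : ℝ) • (f + MvPolynomial.C (ε / 3) - G + MvPolynomial.C (ε / 3) - σ) := by
    rw [neg_one_smul, two_mul, map_add]; ring
  rw [heq]
  refine (weightedL1_add_le hR _ _).trans ?_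
  rw [weightedL1_smul, MvPolynomial.C_apply, weightedL1_monomial, abs_of_pos (by positivity)]
  simp only [abs_neg, abs_one, map_zero, pow_zero]
  linarith

end SosApprox

/-! ### The approximating sequence -/

theorem mainTheorem1 (n r : ℕ) (g : Fin r → MvPolynomial (Fin n) ℝ)
    (f : MvPolynomial (Fin n) ℝ)
    (hf : ∀ x ∈ SosApprox.basicClosedSet g, 0 ≤ MvPolynomial.eval x f) :
    ∃ F : ℕ → MvPolynomial (Fin n) ℝ,
      (∀ ν, F ν ∈ SosApprox.quadraticModule g) ∧
      (∀ ν, F ν ∈ SosApprox.sosCone g) ∧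
      (∀ K : Set (Fin n → ℝ), IsCompact K →
        TendstoUniformlyOn (fun ν x => MvPolynomial.eval x (F ν))
          (fun x => MvPolynomial.eval x f) atTop K) ∧
      Tendsto (fun ν => SosApprox.l1Norm (F ν - f)) atTop (𝓝 0) := by
  -- The weight `ν + 1` grows, so the cubes eventually contain any compact set; it is at least 1, so
  -- the norm also dominates the `l₁`-norm.
  choose F hF hFle using fun ν : ℕ =>
    SosApprox.exists_mem_sosCone_weightedL1_le g f hf (R := (ν : ℝ) + 1)
      (ε := 1 / ((ν : ℝ) + 1)) (by positivity) (by positivity)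
  refine ⟨F, fun ν => SosApprox.sosCone_subset_quadraticModule g (hF ν), hF, fun K hK => ?_, ?_⟩
  · rw [Metric.tendstoUniformlyOn_iff]
    intro ε hε
    obtain ⟨M, hM⟩ := hK.isBounded.exists_norm_le
    filter_upwards [eventually_ge_atTop ⌈M⌉₊,
      tendsto_one_div_add_atTop_nhds_zero_nat.eventually_lt_const hε] with ν hν hνε x hx
    have hMν : M ≤ ν := (Nat.le_ceil M).trans (by exact_mod_cast hν)
    rw [dist_comm, Real.dist_eq, ← map_sub]
    refine ((SosApprox.abs_eval_le_weightedL1 (fun i => ?_) _).trans (hFle ν)).trans_lt hνε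
    have h1 := norm_le_pi_norm x i
    rw [Real.norm_eq_abs] at h1
    linarith [hM x hx]
  · refine squeeze_zero (fun ν => Finset.sum_nonneg fun _ _ => abs_nonneg _) (fun ν => ?_)
      tendsto_one_div_add_atTop_nhds_zero_nat
    exact (SosApprox.l1Norm_le_weightedL1 (by linarith [ν.cast_nonneg (α := ℝ)]) _).trans (hFle ν)
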